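/- **Theorem 5.1.** Let $k$ be a field. A *variety* over $k$ is a reduced separated scheme of finite type over $k$, and $K_0(Var_k)$ is the Grothendieck ring of varieties: the abelian group generated by isomorphism classes of varieties over $k$ modulo the relations $[X]=[X\setminus Y]+[Y]$ for $Y\subset X$ a closed subvariety, with product $[X]\cdot[Z]=[(X\times_k Z)_{\mathrm{red}}]$. Put $\mathbb{L}=[\mathbb{A}^1_k]$. Let $1\le d\le n$, let $h_1,\dots,h_d\in k[x_0,\dots,x_n]$ be nonzero homogeneous polynomials of degree $1$ (not necessarily distinct), and let $X=V(h_1\cdots h_d)\subset\mathbb{P}^n_k$ be the union of the corresponding hyperplanes, with its reduced structure. Then: 1. $X(k)\neq\emptyset$ and $[X]\equiv 1 \bmod \mathbb{L}$ in $K_0(Var_k)$; in particular, the equivalence "$X(k)\ne\emptyset$ if and only if $[X]\equiv 1\bmod\mathbb{L}$" holds for $X$. 2. Let $r$ be the codimension in $\mathbb{P}^n_k$ of the linear subspace $\bigcap_{i=1}^d V(h_i)$, that is, the codimension in $k^{n+1}$ of the space of common zeros of $h_1,\dots,h_d$. Then $1\le r\le n$, and there are linearly independent linear forms $y_0,\dots,y_{r-1}\in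 k[x_0,\dots,x_n]$ and linear forms $g_1,\dots,g_d\in k[t_0,\dots,t_{r-1}]$ such that $h_i=g_i(y_0,\dots,y_{r-1})$ for all $i$. For every such choice, $$[X]=1+\mathbb{L}+\dots+\mathbb{L}^{n-r}+\mathbb{L}^{n-r+1}\cdot[Z]\quad\text{in } K_0(Var_k),$$ where $Z=V(g_1\cdots g_d)\subset\mathbb{P}^{r-1}_k$ with its reduced structure. -/

import Mathlib

open CategoryTheory Limits AlgebraicGeometry MonoidalCategory CartesianMonoidalCategory

universe u

noncomputable section

namespace MotivicClass

/-- The closed subset `Z` of `X` with its reduced induced scheme structure. -/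
abbrev redSub {X : Scheme.{u}} (Z : TopologicalSpace.Closeds X) : Scheme.{u} :=
  (Scheme.IdealSheafData.vanishingIdeal Z).subscheme

/-- The closed immersion of `redSub Z` into `X`. -/
abbrev redSubι {X : Scheme.{u}} (Z : TopologicalSpace.Closeds X) : redSub Z ⟶ X :=
  (Scheme.IdealSheafData.vanishingIdeal Z).subschemeι

instance isReduced_redSub {X : Scheme.{u}} (Z : TopologicalSpace.Closeds X) :
    IsReduced (redSub Z) := by
  have h (U : X.affineOpens) :
      _root_.IsReduced (Γ(X, U.1) ⧸ (Scheme.IdealSheafData.vanishingIdeal Z).ideal U) := by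
    rw [← Ideal.isRadical_iff_quotient_reduced, Scheme.IdealSheafData.vanishingIdeal_ideal]
    exact PrimeSpectrum.isRadical_vanishingIdeal _
  have h' (i : (Scheme.IdealSheafData.vanishingIdeal Z).subschemeCover.openCover.I₀) :
      IsReduced ((Scheme.IdealSheafData.vanishingIdeal Z).subschemeCover.openCover.X i) := by
    have := h i
    exact inferInstanceAs (IsReduced (Spec (.of (_ ⧸ _))))
  exact IsReduced.of_openCover _ (Scheme.IdealSheafData.vanishingIdeal Z).subschemeCover.openCover

/-- The reduction `X_red` of `X`. -/
abbrev red (X : Scheme.{u}) : Scheme.{u} := redSub (⊤ : TopologicalSpace.Closeds X)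

/-- The closed immersion `X_red ⟶ X`. -/
abbrev redι (X : Scheme.{u}) : red X ⟶ X := redSubι ⊤

instance surjective_redι (X : Scheme.{u}) : Surjective (redι X) := by
  rw [surjective_iff, ← Set.range_eq_univ, Scheme.IdealSheafData.range_subschemeι,
    Scheme.IdealSheafData.coe_support_vanishingIdeal]
  rfl

/-- A morphism from a reduced scheme factors through the reduction of the target. -/
def redLift {W X : Scheme.{u}} [IsReduced W] (f : W ⟶ X) : W ⟶ red X :=
  IsClosedImmersion.lift (redι X) f (by
    rw [Scheme.IdealSheafData.ker_subschemeι, Scheme.IdealSheafData.vanishingIdeal_top]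
    refine Scheme.IdealSheafData.le_ofIdeals_iff.mpr fun U x hx ↦ ?_
    have hx' : x ∈ (⊥ : Ideal Γ(X, U)).radical := by
      simpa [Scheme.nilradical] using hx
    obtain ⟨m, hm⟩ := hx'
    rw [RingHom.mem_ker]
    have h2 : ((f.app U).hom x) ^ m = 0 := by
      rw [← map_pow, (Ideal.mem_bot).mp hm, map_zero]
    exact eq_zero_of_pow_eq_zero h2)

lemma redLift_redι {W X : Scheme.{u}} [IsReduced W] (f : W ⟶ X) :
    redLift f ≫ redι X = f :=
  IsClosedImmersion.lift_fac _ _ _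

variable (k : Type u) [Field k]

/-- A `k`-scheme is a variety if it is reduced, separated and of finite type over `k`
(that is, locally of finite type and quasi-compact). -/
def isVariety : ObjectProperty (Over (Spec (.of k))) := fun X ↦
  IsReduced X.left ∧ IsSeparated X.hom ∧ LocallyOfFiniteType X.hom ∧ QuasiCompact X.hom

/-- The category of varieties over `k`, with all `k`-morphisms. -/
abbrev Var : Type (u + 1) := (isVariety k).FullSubcategory

variable {k}

/-- The underlying scheme of a variety. -/
abbrev Var.sch (X : Var k) : Scheme.{u} := X.obj.left

/-- The structure morphism of a variety. -/
abbrev Var.str (X : Var k) : X.sch ⟶ Spec (.of k) := X.obj.hom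

/-- The morphism of schemes underlying a morphism of varieties. -/
abbrev Var.schHom {X Y : Var k} (f : X ⟶ Y) : X.sch ⟶ Y.sch := f.hom.left

/-- The variety with given underlying scheme and structure morphism. -/
abbrev Var.mk' {X : Scheme.{u}} (f : X ⟶ Spec (.of k)) [IsReduced X] [IsSeparated f]
    [LocallyOfFiniteType f] [QuasiCompact f] : Var k :=
  ⟨Over.mk f, ‹_›, ‹_›, ‹_›, ‹_›⟩

instance (X : Var k) : IsReduced X.sch := X.property.1
instance (X : Var k) : IsSeparated X.str := X.property.2.1
instance (X : Var k) : LocallyOfFiniteType X.str := X.property.2.2.1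
instance (X : Var k) : QuasiCompact X.str := X.property.2.2.2

variable (k) in
/-- The variety `Spec k`. -/
abbrev pt : Var k := Var.mk' (𝟙 (Spec (.of k)))

/-- The structure morphism of the fibre product of two varieties over `k`. -/
abbrev pbStr (X Y : Var k) : pullback X.str Y.str ⟶ Spec (.of k) := pullback.fst _ _ ≫ X.str

/-- The product of two varieties: the reduction of their fibre product over `k`. -/
abbrev prodVar (X Y : Var k) : Var k :=
  Var.mk' (redι (pullback X.str Y.str) ≫ pbStr X Y)

/-- The first projection. -/
def prodFst (X Y : Var k) : prodVar X Y ⟶ X :=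
  ObjectProperty.homMk (Over.homMk (redι _ ≫ pullback.fst X.str Y.str) (by simp))

/-- The second projection. -/
def prodSnd (X Y : Var k) : prodVar X Y ⟶ Y :=
  ObjectProperty.homMk (Over.homMk (redι _ ≫ pullback.snd X.str Y.str)
    (by simp [pullback.condition]))

lemma lift_aux {W X Y : Var k} (f : W ⟶ X) (g : W ⟶ Y) :
    Var.schHom f ≫ X.str = Var.schHom g ≫ Y.str :=
  (Over.w f.hom).trans (Over.w g.hom).symm

/-- The morphism to the product with given components. -/
def prodLift {W X Y : Var k} (f : W ⟶ X) (g : W ⟶ Y) : W ⟶ prodVar X Y :=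
  ObjectProperty.homMk (Over.homMk
    (redLift (pullback.lift (Var.schHom f) (Var.schHom g) (lift_aux f g)))
    (by
      refine (reassoc_of% redLift_redι _) _ |>.trans ?_
      exact (pullback.lift_fst_assoc _ _ _ _).trans (Over.w f.hom)))

lemma prodLift_fst {W X Y : Var k} (f : W ⟶ X) (g : W ⟶ Y) :
    prodLift f g ≫ prodFst X Y = f := by
  ext1; ext1
  exact (reassoc_of% redLift_redι _) _ |>.trans (pullback.lift_fst _ _ _)

lemma prodLift_snd {W X Y : Var k} (f : W ⟶ X) (g : W ⟶ Y) :
    prodLift f g ≫ prodSnd X Y = g := by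
  ext1; ext1
  exact (reassoc_of% redLift_redι _) _ |>.trans (pullback.lift_snd _ _ _)

lemma prod_hom_ext {W X Y : Var k} {f g : W ⟶ prodVar X Y}
    (h₁ : f ≫ prodFst X Y = g ≫ prodFst X Y) (h₂ : f ≫ prodSnd X Y = g ≫ prodSnd X Y) :
    f = g := by
  have e₁ : Var.schHom f ≫ redι _ ≫ pullback.fst X.str Y.str =
    Var.schHom g ≫ redι _ ≫ pullback.fst X.str Y.str := congr(Var.schHom $h₁)
  have e₂ : Var.schHom f ≫ redι _ ≫ pullback.snd X.str Y.str =
    Var.schHom g ≫ redι _ ≫ pullback.snd X.str Y.str := congr(Var.schHom $h₂)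
  ext1; ext1
  rw [← cancel_mono (redι (pullback X.str Y.str))]
  apply pullback.hom_ext
  · simpa only [Category.assoc] using e₁
  · simpa only [Category.assoc] using e₂

variable (k) in
/-- `Spec k` is the terminal variety. -/
def ptIsTerminal : IsTerminal (pt k) :=
  IsTerminal.ofUniqueHom (fun X ↦ ObjectProperty.homMk (Over.homMk X.str (by simp)))
    (fun X m ↦ by ext1; ext1; simpa using Over.w m.hom)

/-- `(X ×ₖ Y)_red` is the product of `X` and `Y` in the category of varieties. -/
def prodIsLimit (X Y : Var k) : IsLimit (BinaryFan.mk (prodFst X Y) (prodSnd X Y)) :=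
  BinaryFan.IsLimit.mk _ prodLift prodLift_fst prodLift_snd
    (fun f g _ h₁ h₂ ↦ prod_hom_ext (h₁.trans (prodLift_fst f g).symm)
      (h₂.trans (prodLift_snd f g).symm))

/-- The product structure on varieties: `X ⊗ Y` is `prodVar X Y` and the unit is `Spec k`. -/
instance : CartesianMonoidalCategory (Var k) :=
  .ofChosenFiniteProducts ⟨_, ptIsTerminal k⟩ fun X Y ↦ ⟨_, prodIsLimit X Y⟩

instance : BraidedCategory (Var k) := .ofCartesianMonoidalCategory


/-- `i` is the inclusion of a closed subvariety `Y` of `X`, and `j` is the inclusion of its open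
complement, so that `U` is (uniquely isomorphic over `X` to) `X ∖ Y`. -/
structure IsScissor {X Y U : Var k} (i : Y ⟶ X) (j : U ⟶ X) : Prop where
  isClosedImmersion : IsClosedImmersion (Var.schHom i)
  isOpenImmersion : IsOpenImmersion (Var.schHom j)
  range_eq : Set.range (Var.schHom j) = (Set.range (Var.schHom i))ᶜ

/-- The morphism `f × id` of fibre products over `k` induced by `f : Y ⟶ X`. -/
abbrev pbMap {X Y : Var k} (f : Y ⟶ X) (Z : Var k) :
    pullback Y.str Z.str ⟶ pullback X.str Z.str :=
  pullback.map _ _ _ _ (Var.schHom f) (𝟙 _) (𝟙 _) (by simp) (by simp)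

lemma pbMap_fst {X Y : Var k} (f : Y ⟶ X) (Z : Var k) :
    pbMap f Z ≫ pullback.fst X.str Z.str = pullback.fst Y.str Z.str ≫ Var.schHom f :=
  pullback.lift_fst _ _ _

lemma pbMap_snd {X Y : Var k} (f : Y ⟶ X) (Z : Var k) :
    pbMap f Z ≫ pullback.snd X.str Z.str = pullback.snd Y.str Z.str :=
  (pullback.lift_snd _ _ _).trans (Category.comp_id _)

lemma isPullback_pbMap {X Y : Var k} (f : Y ⟶ X) (Z : Var k) :
    IsPullback (pbMap f Z) (pullback.fst Y.str Z.str) (pullback.fst X.str Z.str)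
      (Var.schHom f) := by
  refine .of_right (h₁₂ := pullback.snd X.str Z.str) (h₂₂ := X.str) (v₁₃ := Z.str) ?_
    (pbMap_fst f Z) (IsPullback.of_hasPullback _ _).flip
  have e : Var.schHom f ≫ X.str = Y.str := Over.w f.hom
  rw [pbMap_snd, e]
  exact (IsPullback.of_hasPullback _ _).flip

lemma whiskerRight_redι {X Y : Var k} (f : Y ⟶ X) (Z : Var k) :
    Var.schHom (f ▷ Z) ≫ redι (pullback X.str Z.str) = redι (pullback Y.str Z.str) ≫ pbMap f Z := by
  have h₁ : Var.schHom (f ▷ Z) ≫ redι _ ≫ pullback.fst X.str Z.str =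
      redι _ ≫ pullback.fst Y.str Z.str ≫ Var.schHom f :=
    (congr(Var.schHom $(whiskerRight_fst f Z))).trans (Category.assoc _ _ _)
  have h₂ : Var.schHom (f ▷ Z) ≫ redι _ ≫ pullback.snd X.str Z.str =
      redι _ ≫ pullback.snd Y.str Z.str :=
    congr(Var.schHom $(whiskerRight_snd f Z))
  apply pullback.hom_ext
  · rw [Category.assoc, Category.assoc, pbMap_fst, h₁]
  · rw [Category.assoc, Category.assoc, pbMap_snd, h₂]

lemma range_whiskerRight {X Y : Var k} (f : Y ⟶ X) (Z : Var k) :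
    Set.range (Var.schHom (f ▷ Z)) =
      (redι _ ≫ pullback.fst X.str Z.str) ⁻¹' Set.range (Var.schHom f) := by
  have hr : Set.range (pbMap f Z) = pullback.fst X.str Z.str ⁻¹' Set.range (Var.schHom f) := by
    rw [Scheme.Pullback.range_map]
    simp
  rw [Scheme.Hom.comp_base, TopCat.coe_comp, Set.preimage_comp, ← hr]
  have hw (y) : redι _ (Var.schHom (f ▷ Z) y) = pbMap f Z (redι _ y) := by
    rw [← Scheme.Hom.comp_apply, whiskerRight_redι, Scheme.Hom.comp_apply]
  ext x
  constructor
  · rintro ⟨y, rfl⟩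
    exact ⟨_, (hw y).symm⟩
  · rintro ⟨y, hy⟩
    obtain ⟨y, rfl⟩ := (redι (pullback Y.str Z.str)).surjective y
    exact ⟨y, (redι (pullback X.str Z.str)).isClosedEmbedding.injective ((hw y).trans hy)⟩

lemma isOpenImmersion_whiskerRight {X U : Var k} (j : U ⟶ X) (Z : Var k)
    [IsOpenImmersion (Var.schHom j)] : IsOpenImmersion (Var.schHom (j ▷ Z)) := by
  have : IsOpenImmersion (pbMap j Z) :=
    MorphismProperty.of_isPullback (isPullback_pbMap j Z).flip ‹_›
  let a := pullback.fst (redι (pullback X.str Z.str)) (pbMap j Z)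
  let b := pullback.snd (redι (pullback X.str Z.str)) (pbMap j Z)
  have : IsReduced (pullback (redι (pullback X.str Z.str)) (pbMap j Z)) :=
    isReduced_of_isOpenImmersion a
  let g : (U ⊗ Z).sch ⟶ pullback (redι (pullback X.str Z.str)) (pbMap j Z) :=
    pullback.lift (Var.schHom (j ▷ Z)) (redι _) (whiskerRight_redι j Z)
  have hga : g ≫ a = Var.schHom (j ▷ Z) := pullback.lift_fst _ _ _
  have hgb : g ≫ b = redι _ := pullback.lift_snd _ _ _
  have hb : IsClosedImmersion b := inferInstance
  have : IsClosedImmersion (g ≫ b) := by rw [hgb]; infer_instance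
  have : IsClosedImmersion g := .of_comp_isClosedImmersion g b
  have : Surjective g := ⟨fun x ↦ by
    obtain ⟨y, hy⟩ := (redι (pullback U.str Z.str)).surjective (b x)
    refine ⟨y, b.isClosedEmbedding.injective ?_⟩
    rw [← hy, ← hgb, Scheme.Hom.comp_apply]⟩
  have := isIso_of_isClosedImmersion_of_surjective g
  rw [← hga]
  infer_instance

lemma IsScissor.whiskerRight {X Y U : Var k} {i : Y ⟶ X} {j : U ⟶ X} (h : IsScissor i j)
    (Z : Var k) : IsScissor (i ▷ Z) (j ▷ Z) where
  isClosedImmersion := by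
    have := h.isClosedImmersion
    have : IsClosedImmersion (pbMap i Z) :=
      MorphismProperty.of_isPullback (isPullback_pbMap i Z).flip ‹_›
    have h2 : IsClosedImmersion (Var.schHom (i ▷ Z) ≫ redι (pullback X.str Z.str)) := by
      rw [whiskerRight_redι]; infer_instance
    exact .of_comp_isClosedImmersion _ (redι _)
  isOpenImmersion := by
    have := h.isOpenImmersion
    exact isOpenImmersion_whiskerRight j Z
  range_eq := by
    rw [range_whiskerRight, range_whiskerRight, h.range_eq]; rfl

/-- The generator of the free abelian group on isomorphism classes of varieties that is given by the
class of `X` (the elements of `Skeleton C` are the isomorphism classes of objects of `C`).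
This group is a ring, with the product of varieties as multiplication on generators. -/
def gen (X : Var k) : FreeAbelianGroup (Skeleton (Var k)) := .of (toSkeleton X)

lemma gen_mul (X Y : Var k) : gen X * gen Y = gen (X ⊗ Y) := by
  rw [gen, gen, gen, FreeAbelianGroup.of_mul_of, Skeleton.toSkeleton_tensorObj]

variable (k) in
/-- The subgroup generated by the scissor relations `[X] - ([X ∖ Y] + [Y])`. -/
def scissorSubgroup : AddSubgroup (FreeAbelianGroup (Skeleton (Var k))) :=
  AddSubgroup.closure {x | ∃ (X Y U : Var k) (i : Y ⟶ X) (j : U ⟶ X), IsScissor i j ∧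
    x = gen X - (gen U + gen Y)}

lemma mul_mem_scissorSubgroup (a x : FreeAbelianGroup (Skeleton (Var k)))
    (hx : x ∈ scissorSubgroup k) : a * x ∈ scissorSubgroup k := by
  induction a using FreeAbelianGroup.induction_on with
  | zero => rw [zero_mul]; exact zero_mem _
  | of Z =>
    induction hx using AddSubgroup.closure_induction with
    | mem x hx =>
      obtain ⟨X, Y, U, i, j, h, rfl⟩ := hx
      have hZ : FreeAbelianGroup.of Z = gen Z.out := by
        rw [gen]; exact congrArg _ (Quotient.out_eq Z).symm
      refine AddSubgroup.subset_closure ⟨_, _, _, _, _, h.whiskerRight Z.out, ?_⟩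
      rw [mul_comm, hZ, sub_mul, add_mul, gen_mul, gen_mul, gen_mul]
    | zero => rw [mul_zero]; exact zero_mem _
    | add x y _ _ hx hy => rw [mul_add]; exact add_mem hx hy
    | neg x _ hx => rw [mul_neg]; exact neg_mem hx
  | neg Z hZ => rw [neg_mul]; exact neg_mem hZ
  | add a b ha hb => rw [add_mul]; exact add_mem ha hb

variable (k) in
/-- The subgroup generated by the scissor relations, as an ideal. -/
def scissorIdeal : Ideal (FreeAbelianGroup (Skeleton (Var k))) where
  __ := scissorSubgroup k
  smul_mem' a x hx := mul_mem_scissorSubgroup a x hx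

variable (k) in
/-- The Grothendieck ring of varieties over `k`: the abelian group generated by isomorphism classes
of varieties modulo the scissor relations, with `[X] * [Y] = [X ×ₖ Y]`. -/
abbrev K0 : Type (u + 1) := FreeAbelianGroup (Skeleton (Var k)) ⧸ scissorIdeal k

/-- The class `[X]` of a variety in the Grothendieck ring. -/
def cls (X : Var k) : K0 k := Ideal.Quotient.mk _ (gen X)

variable (k) in
/-- The affine line over `k`. -/
abbrev affineLine : Var k := Var.mk' (𝔸(PUnit; Spec (.of k)) ↘ Spec (.of k))

variable (k) in
/-- The Lefschetz class `𝕃 = [𝔸¹]`. -/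
def 𝕃 : K0 k := cls (affineLine k)

section Projective

variable (k) (σ : Type)

attribute [local instance] MvPolynomial.gradedAlgebra

/-- Projective space `Proj k[x_i : i ∈ σ]`, of dimension `|σ| - 1`. -/
abbrev ProjSp : Scheme.{u} := Proj (MvPolynomial.homogeneousSubmodule σ k)

/-- The structure morphism of projective space over `k`. -/
def ProjSp.str : ProjSp k σ ⟶ Spec (.of k) :=
  Proj.toSpecZero (MvPolynomial.homogeneousSubmodule σ k) ≫
    Spec.map (CommRingCat.ofHom (algebraMap k (MvPolynomial.homogeneousSubmodule σ k 0)))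

lemma finiteType_zero [Finite σ] :
    Algebra.FiniteType (MvPolynomial.homogeneousSubmodule σ k 0) (MvPolynomial σ k) :=
  have : IsScalarTower k (MvPolynomial.homogeneousSubmodule σ k 0) (MvPolynomial σ k) :=
    ⟨fun a b c ↦ smul_mul_assoc a (b : MvPolynomial σ k) c⟩
  .of_restrictScalars_finiteType k _ _

lemma surjective_algebraMap_zero :
    Function.Surjective (algebraMap k (MvPolynomial.homogeneousSubmodule σ k 0)) := by
  rintro ⟨f, hf⟩
  refine ⟨f.coeff 0, Subtype.ext ?_⟩
  have := MvPolynomial.totalDegree_eq_zero_iff_eq_C.mp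
    (Nat.le_zero.mp (MvPolynomial.IsHomogeneous.totalDegree_le hf))
  exact this.symm

instance [Finite σ] : IsProper (ProjSp.str k σ) := by
  have := finiteType_zero k σ
  have : IsClosedImmersion (Spec.map
      (CommRingCat.ofHom (algebraMap k (MvPolynomial.homogeneousSubmodule σ k 0)))) :=
    .spec_of_surjective _ (surjective_algebraMap_zero k σ)
  unfold ProjSp.str
  infer_instance

variable {k σ}

/-- The closed subset of projective space where the homogeneous polynomial `f` vanishes. -/
def zeroSet (f : MvPolynomial σ k) : TopologicalSpace.Closeds (ProjSp k σ) :=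
  ⟨ProjectiveSpectrum.zeroLocus (MvPolynomial.homogeneousSubmodule σ k) {f},
    ProjectiveSpectrum.isClosed_zeroLocus _ _⟩

/-- The variety `V(f)` in projective space, with its reduced structure. -/
abbrev hypersurface [Finite σ] (f : MvPolynomial σ k) : Var k :=
  Var.mk' (redSubι (zeroSet f) ≫ ProjSp.str k σ)

end Projective

/-- The codimension of the linear subspace of projective space that is cut out by the linear forms
`h i`: the codimension in `k^σ` of the subspace of common zeros of the `h i`. For linear forms
the set below is already a subspace. -/
def linearCodim {ι σ : Type} (h : ι → MvPolynomial σ k) : ℕ :=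
  Module.finrank k ((σ → k) ⧸ Submodule.span k {v : σ → k | ∀ i, MvPolynomial.eval v (h i) = 0})

/-- `y` is a part of a system of homogeneous linear coordinates, and in these coordinates the
linear forms `h i` are the linear forms `g i` in the `y j` alone: `h i = g i (y)`. -/
structure IsCoordinateForm {ι σ τ : Type} (y : τ → MvPolynomial σ k) (g : ι → MvPolynomial τ k)
    (h : ι → MvPolynomial σ k) : Prop where
  isHomogeneous_coord : ∀ j, (y j).IsHomogeneous 1
  linearIndependent : LinearIndependent k y
  isHomogeneous : ∀ i, (g i).IsHomogeneous 1
  aeval_eq : ∀ i, MvPolynomial.aeval y (g i) = h i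

end MotivicClass

end

open MotivicClass

/-! Let `r` be the rank of the forms `h i`. In suitable linear coordinates their product involves
only the last `r` variables. Since `r ≤ d ≤ n`, there are `m = n - r + 1 ≥ 1` free variables, and
`X` is an `m`-fold iterated cone over `Z`. A cone consists of its vertex, of class `1`, and of a
part fibred in affine lines over the base, so `[cone] = 1 + 𝕃 [base]`. Iterating this gives the
formula; modulo `𝕃` only the `1` of the last vertex survives, and that vertex is a rational point.

No projection from the vertex is constructed. Instead the flag of coordinate subspaces cuts a
projective variety into affine strata, one for each possible last nonvanishing coordinate, which is
normalised to `1` (`cls_projVar_eq_add`, iterated in `cls_projVar_eq_sum`). The rest is algebra with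
coordinate rings up to nilpotents (`affCls`): a new free variable in front adds a stratum that is a
point (`affCls_stratum_zero`) and replaces each old stratum by its product with the affine line
(`affCls_stratum_succ`). Together these give `strataSum_rename_succ`. The coordinates come from
extending a basis of the span of the `h i` (`exists_isCoordinateForm`, `exists_coordinates`). -/

noncomputable section

namespace MotivicClass

/-! ### Reduced closed subschemes are determined by their points -/

section Immersions

/-- A morphism from a reduced scheme factors through a closed immersion as soon as it does so
on points. -/
lemma exists_lift_of_range_subset {X Y Z : Scheme.{u}} (f : X ⟶ Z) (g : Y ⟶ Z)
    [IsClosedImmersion f] [IsReduced Y] (h : Set.range g ⊆ Set.range f) :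
    ∃ l : Y ⟶ X, l ≫ f = g := by
  -- The base change of `f` to `Y` is a closed immersion that hits every point; as `Y` is reduced,
  -- it is an isomorphism, and its inverse yields the lift.
  have : Surjective (pullback.snd f g) := by
    rw [surjective_iff, ← Set.range_eq_univ, Scheme.Pullback.range_snd, Set.preimage_eq_univ_iff]
    exact h
  have := isIso_of_isClosedImmersion_of_surjective (pullback.snd f g)
  exact ⟨inv (pullback.snd f g) ≫ pullback.fst f g, by simp [pullback.condition]⟩

/-- Reduced closed subschemes with the same points are isomorphic. -/
lemma exists_iso_of_range_eq {X Y Z : Scheme.{u}} (f : X ⟶ Z) (g : Y ⟶ Z)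
    [IsClosedImmersion f] [IsClosedImmersion g] [IsReduced X] [IsReduced Y]
    (h : Set.range g = Set.range f) : ∃ e : Y ≅ X, e.hom ≫ f = g := by
  obtain ⟨l, hl⟩ := exists_lift_of_range_subset f g h.le
  obtain ⟨m, hm⟩ := exists_lift_of_range_subset g f h.ge
  refine ⟨⟨l, m, ?_, ?_⟩, hl⟩
  · rw [← cancel_mono g, Category.assoc, hm, hl, Category.id_comp]
  · rw [← cancel_mono f, Category.assoc, hl, hm, Category.id_comp]

end Immersions

/-! ### Formal properties of classes in the Grothendieck ring -/

section Classes

variable {k : Type u} [Field k]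

/-- A morphism of varieties from a morphism of schemes over `k`. -/
abbrev Var.homMk' {X Y : Var k} (f : X.sch ⟶ Y.sch) (hf : f ≫ Y.str = X.str) : X ⟶ Y :=
  ObjectProperty.homMk (Over.homMk f hf)

lemma cls_eq_of_iso {X Y : Var k} (e : X ≅ Y) : cls X = cls Y := by
  have : toSkeleton X = toSkeleton Y := Quotient.sound ⟨e⟩
  rw [cls, cls, gen, gen, this]

lemma cls_eq_of_schIso {X Y : Var k} (e : X.sch ≅ Y.sch) (he : e.hom ≫ Y.str = X.str) :
    cls X = cls Y :=
  cls_eq_of_iso ⟨Var.homMk' e.hom he, Var.homMk' e.inv (by rw [← he, e.inv_hom_id_assoc]),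
    by ext1; ext1; exact e.hom_inv_id, by ext1; ext1; exact e.inv_hom_id⟩

lemma IsScissor.cls_eq {X Y U : Var k} {i : Y ⟶ X} {j : U ⟶ X} (h : IsScissor i j) :
    cls X = cls U + cls Y := by
  rw [cls, cls, cls, ← map_add, Ideal.Quotient.eq]
  exact AddSubgroup.subset_closure ⟨X, Y, U, i, j, h, rfl⟩

lemma cls_tensor (X Y : Var k) : cls (X ⊗ Y) = cls X * cls Y := by
  rw [cls, cls, cls, ← map_mul, gen_mul]

lemma cls_eq_of_range_eq {X Y : Var k} {P : Scheme.{u}} (p : P ⟶ Spec (.of k))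
    (i : X.sch ⟶ P) (j : Y.sch ⟶ P) [IsClosedImmersion i] [IsClosedImmersion j]
    (hi : i ≫ p = X.str) (hj : j ≫ p = Y.str) (h : Set.range i = Set.range j) :
    cls X = cls Y := by
  obtain ⟨e, he⟩ := exists_iso_of_range_eq j i h
  exact cls_eq_of_schIso e (by rw [← hj, reassoc_of% he, hi])

/-- The empty variety is its own closed subvariety and its own open complement, so `[X] = [X] +
[X]`. -/
lemma cls_eq_zero_of_isEmpty (X : Var k) [IsEmpty X.sch] : cls X = 0 := by
  have : IsScissor (𝟙 X) (𝟙 X) :=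
    ⟨inferInstanceAs (IsClosedImmersion (𝟙 X.sch)), inferInstanceAs (IsOpenImmersion (𝟙 X.sch)),
      Set.ext fun x ↦ isEmptyElim x⟩
  simpa using this.cls_eq

/-- The scissor relation for a closed subvariety `X` of an ambient scheme `P` that is cut by an
open subscheme `V` of `P`. -/
lemma cls_eq_add {X Y T : Var k} {P V : Scheme.{u}} (p : P ⟶ Spec (.of k)) (v : V ⟶ P)
    [IsOpenImmersion v] (x : X.sch ⟶ P) (y : Y.sch ⟶ P) (t : T.sch ⟶ V)
    [IsClosedImmersion x] [IsClosedImmersion y] [IsClosedImmersion t]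
    (hx : x ≫ p = X.str) (hy : y ≫ p = Y.str) (ht : t ≫ v ≫ p = T.str)
    (hxy : Set.range y = Set.range x \ Set.range v) (hxt : Set.range t = v ⁻¹' Set.range x) :
    cls X = cls T + cls Y := by
  obtain ⟨i, hi⟩ := exists_lift_of_range_subset x y (hxy.trans_subset Set.sdiff_subset)
  -- `X ∩ V` is open in `X`, hence reduced. It and `T` are then reduced closed subschemes of `V`
  -- with the same points, which identifies `T` with an open subscheme of `X`.
  have : IsReduced (pullback x v) := isReduced_of_isOpenImmersion (pullback.fst x v)
  obtain ⟨e, he⟩ := exists_iso_of_range_eq (pullback.snd x v) t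
    (by rw [hxt, Scheme.Pullback.range_snd])
  let j : T.sch ⟶ X.sch := e.hom ≫ pullback.fst x v
  have hj : j ≫ x = t ≫ v := by rw [Category.assoc, pullback.condition, reassoc_of% he]
  have hinj := x.isClosedEmbedding.injective
  refine IsScissor.cls_eq (i := Var.homMk' i (by rw [← hx, reassoc_of% hi, hy]))
    (j := Var.homMk' j (by rw [← hx, reassoc_of% hj, ht])) ⟨?_, ?_, ?_⟩
  · have : IsClosedImmersion (i ≫ x) := by rw [hi]; infer_instance
    exact .of_comp_isClosedImmersion i x
  · exact inferInstanceAs (IsOpenImmersion (e.hom ≫ pullback.fst x v))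
  · have h1 : Set.range j = x ⁻¹' Set.range v := by
      have : Surjective e.hom := inferInstance
      rw [Scheme.Hom.comp_base, TopCat.coe_comp, this.surj.range_comp,
        Scheme.Pullback.range_fst]
    have h2 : Set.range i = x ⁻¹' Set.range y := by
      rw [← hi, Scheme.Hom.comp_base, TopCat.coe_comp, Set.range_comp,
        Set.preimage_image_eq _ hinj]
    change Set.range j = (Set.range i)ᶜ
    rw [h1, h2, hxy]
    ext a
    simp

end Classes

/-! ### Classes of affine varieties and of relative affine lines -/

section Affine

open Polynomial

variable (k : Type u) [Field k]

/-- The affine variety with coordinate ring `R_red`. -/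
abbrev redSpec (R : Type u) [CommRing R] [Algebra k R] [Algebra.FiniteType k R] : Var k :=
  have : _root_.IsReduced (R ⧸ nilradical R) :=
    (Ideal.isRadical_iff_quotient_reduced _).mp (Ideal.radical_isRadical _)
  have : LocallyOfFiniteType
      (Spec.map (CommRingCat.ofHom (algebraMap k (R ⧸ nilradical R)))) := by
    rw [HasRingHomProperty.Spec_iff (P := @LocallyOfFiniteType)]
    exact RingHom.finiteType_algebraMap.mpr inferInstance
  Var.mk' (Spec.map (CommRingCat.ofHom (algebraMap k (R ⧸ nilradical R))))

/-- The class of the affine variety with coordinate ring `R_red`. -/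
def affCls (R : Type u) [CommRing R] [Algebra k R] [Algebra.FiniteType k R] : K0 k :=
  cls (redSpec k R)

variable {k}

lemma isClosedImmersion_specMap {R S : Type u} [CommRing R] [CommRing S] (φ : R →+* S)
    (hφ : Function.Surjective φ) : IsClosedImmersion (Spec.map (CommRingCat.ofHom φ)) :=
  .spec_of_surjective _ hφ

lemma range_specMap_of_surjective {R S : Type u} [CommRing R] [CommRing S] (φ : R →+* S)
    (hφ : Function.Surjective φ) :
    Set.range (Spec.map (CommRingCat.ofHom φ)) =
      PrimeSpectrum.zeroLocus (RingHom.ker φ : Set R) :=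
  range_comap_of_surjective S φ hφ

variable {R S : Type u} [CommRing R] [Algebra k R] [CommRing S] [Algebra k S]
  [Algebra.FiniteType k S]

/-- The affine variety with coordinate ring `S_red` has the class of any variety embedded in
`Spec R` with the same points as `Spec S`. -/
lemma affCls_eq_cls (φ : R →ₐ[k] S) (hφ : Function.Surjective φ) (X : Var k)
    (i : X.sch ⟶ Spec (.of R)) [IsClosedImmersion i]
    (hi : i ≫ Spec.map (CommRingCat.ofHom (algebraMap k R)) = X.str)
    (h : Set.range i = PrimeSpectrum.zeroLocus (RingHom.ker φ : Set R)) :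
    affCls k S = cls X := by
  let ψ : R →ₐ[k] S ⧸ nilradical S := (Ideal.Quotient.mkₐ k _).comp φ
  have hψ : Function.Surjective ψ := (Ideal.Quotient.mkₐ_surjective k _).comp hφ
  have : IsClosedImmersion (Spec.map (CommRingCat.ofHom ψ.toRingHom)) :=
    .spec_of_surjective _ hψ
  refine cls_eq_of_range_eq (X := redSpec k S) _
    (Spec.map (CommRingCat.ofHom ψ.toRingHom)) i ?_ hi ?_
  · rw [← Spec.map_comp, ← CommRingCat.ofHom_comp]
    congr 2
    exact ψ.comp_algebraMap
  -- The kernel of `ψ` is the radical of the kernel of `φ`, so both cut out the same points.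
  · rw [h, range_specMap_of_surjective _ hψ, ← PrimeSpectrum.zeroLocus_radical (RingHom.ker φ)]
    congr 1
    ext x
    simp only [SetLike.mem_coe, RingHom.mem_ker, Ideal.mem_radical_iff]
    change Ideal.Quotient.mk _ (φ x) = 0 ↔ _
    rw [Ideal.Quotient.eq_zero_iff_mem, mem_nilradical]
    simp [IsNilpotent]

variable [Algebra.FiniteType k R]

/-- A quotient by nilpotents has the same points. This is what allows strata to be described by
ideals that need not be radical. -/
lemma affCls_eq_of_surjective (φ : R →ₐ[k] S) (hφ : Function.Surjective φ)
    (h : RingHom.ker φ ≤ nilradical R) : affCls k R = affCls k S := by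
  have : IsClosedImmersion (Spec.map (CommRingCat.ofHom (Ideal.Quotient.mk (nilradical R)))) :=
    .spec_of_surjective _ Ideal.Quotient.mk_surjective
  refine (affCls_eq_cls φ hφ (redSpec k R)
    (Spec.map (CommRingCat.ofHom (Ideal.Quotient.mk (nilradical R)))) ?_ ?_).symm
  · rw [← Spec.map_comp]
    rfl
  · rw [range_specMap_of_surjective _ Ideal.Quotient.mk_surjective, Ideal.mk_ker]
    refine (Set.eq_univ_of_forall fun p x hx ↦ ?_).trans
      (Set.eq_univ_of_forall fun p x hx ↦ ?_).symm
    · exact nilradical_le_prime p.asIdeal hx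
    · exact nilradical_le_prime p.asIdeal (h hx)

lemma affCls_eq_of_algEquiv (e : R ≃ₐ[k] S) : affCls k R = affCls k S :=
  affCls_eq_of_surjective e.toAlgHom e.surjective fun x hx ↦ by
    have : x = 0 := e.injective ((RingHom.mem_ker.mp hx).trans (map_zero e).symm)
    exact this ▸ zero_mem _

variable (k) in
lemma affCls_self : affCls k k = 1 := by
  have h1 : (1 : K0 k) = cls (𝟙_ (Var k)) := by
    rw [cls, ← map_one (Ideal.Quotient.mk _)]
    rfl
  rw [h1]
  have h2 : (RingHom.ker (AlgHom.id k k) : Set k) = {0} := by ext; simp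
  refine affCls_eq_cls (AlgHom.id k k) Function.surjective_id (pt k) (𝟙 _) ?_ ?_
  · exact (Category.id_comp _).trans (Spec.map_id _)
  · rw [h2, PrimeSpectrum.zeroLocus_singleton_zero]
    exact Set.range_id

/-- The relative affine line over a variety. -/
abbrev lineOver (X : Var k) : Var k := Var.mk' (𝔸(PUnit; X.sch) ↘ X.sch ≫ X.str)

/-- The relative line is the fibre product of `𝔸¹` and `X`, whereas the product of varieties is the
reduction of that fibre product. Both are reduced closed subschemes of it containing every point. -/
lemma cls_lineOver (X : Var k) : cls (lineOver X) = 𝕃 k * cls X := by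
  rw [𝕃, ← cls_tensor]
  let P := pullback (affineLine k).str X.str
  let e : 𝔸(PUnit; X.sch) ≅ P := (AffineSpace.isPullback_map (n := PUnit) X.str).isoPullback
  have he : e.hom ≫ pullback.snd _ _ = 𝔸(PUnit; X.sch) ↘ X.sch :=
    (AffineSpace.isPullback_map (n := PUnit) X.str).isoPullback_hom_snd
  refine cls_eq_of_range_eq (P := P) (pbStr (affineLine k) X) e.hom (redι P) ?_ rfl ?_
  · rw [pbStr, pullback.condition, reassoc_of% he]
    rfl
  · rw [(surjective_redι P).surj.range_eq]
    have : Surjective e.hom := inferInstance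
    exact this.surj.range_eq

variable (k R) in
lemma affCls_polynomial : affCls k R[X] = 𝕃 k * affCls k R := by
  rw [affCls, affCls, ← cls_lineOver, ← affCls]
  let R' := R ⧸ nilradical R
  let φ : R[X] →ₐ[k] R'[X] := mapAlgHom (Ideal.Quotient.mkₐ k (nilradical R))
  have hφ : Function.Surjective φ := Polynomial.map_surjective _ Ideal.Quotient.mk_surjective
  -- A polynomial with nilpotent coefficients is nilpotent, so `R` may be replaced by its reduction,
  -- whose spectrum carries the relative line.
  have hker : RingHom.ker φ ≤ nilradical R[X] := fun p hp ↦ by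
    rw [mem_nilradical, Polynomial.isNilpotent_iff]
    intro n
    have : (φ p).coeff n = 0 := by rw [RingHom.mem_ker.mp hp, coeff_zero]
    change (Polynomial.map _ p).coeff n = 0 at this
    rw [coeff_map] at this
    exact mem_nilradical.mp (Ideal.Quotient.eq_zero_iff_mem.mp this)
  rw [affCls_eq_of_surjective φ hφ hker,
    affCls_eq_of_algEquiv ((MvPolynomial.uniqueAlgEquiv R' PUnit.{u + 1}).symm.restrictScalars k)]
  let e := AffineSpace.SpecIso PUnit.{u + 1} (.of R')
  refine affCls_eq_cls (AlgHom.id k _) Function.surjective_id (lineOver (redSpec k R)) e.hom ?_ ?_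
  · have : e.inv ≫ 𝔸(PUnit; Spec (.of R')) ↘ Spec (.of R') ≫
        Spec.map (CommRingCat.ofHom (algebraMap k R')) =
        Spec.map (CommRingCat.ofHom (algebraMap k (MvPolynomial PUnit R'))) := by
      rw [AffineSpace.SpecIso_inv_over_assoc, ← Spec.map_comp]
      rfl
    rw [← this, e.hom_inv_id_assoc]
    rfl
  · have h2 : (RingHom.ker (AlgHom.id k (MvPolynomial PUnit.{u + 1} R')) :
        Set (MvPolynomial PUnit.{u + 1} R')) = {0} := by ext; simp
    have : Surjective e.hom := inferInstance
    rw [h2, PrimeSpectrum.zeroLocus_singleton_zero]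
    exact this.surj.range_eq

end Affine

/-! ### Dehomogenization with respect to a linear form -/

section Dehomogenize

open MvPolynomial HomogeneousLocalization

attribute [local instance] MvPolynomial.gradedAlgebra

variable {k : Type u} [Field k] {σ : Type}

lemma eval₂_mul_of_isHomogeneous {B : Type*} [CommRing B] (f : k →+* B) (c : B) (g : σ → B)
    {a : MvPolynomial σ k} {n : ℕ} (ha : a.IsHomogeneous n) :
    eval₂ f (fun i ↦ c * g i) a = c ^ n * eval₂ f g a := by
  rw [eval₂_eq, eval₂_eq, Finset.mul_sum]
  refine Finset.sum_congr rfl fun d hd ↦ ?_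
  rw [ha.degree_eq_sum_deg_support hd, ← Finset.prod_pow_eq_pow_sum]
  simp_rw [mul_pow]
  rw [Finset.prod_mul_distrib]
  ring

variable {ℓ : MvPolynomial σ k} (hℓ : ℓ ∈ homogeneousSubmodule σ k 1)
  (I : Ideal (MvPolynomial σ k)) (hI : ℓ - 1 ∈ I)

/-- The dehomogenization map on the coordinate ring of the complement of a hyperplane `ℓ = 0`,
which evaluates `ℓ` to `1`. -/
def dehom : Away (homogeneousSubmodule σ k) ℓ →+* MvPolynomial σ k ⧸ I :=
  (IsLocalization.Away.lift (S := Localization.Away ℓ) ℓ (g := Ideal.Quotient.mk I)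
    (by rw [Ideal.Quotient.eq.mpr hI, map_one]; exact isUnit_one)).comp
    (algebraMap _ (Localization.Away ℓ))

lemma dehom_mk (n : ℕ) (a : MvPolynomial σ k) (ha : a ∈ homogeneousSubmodule σ k (n • 1)) :
    dehom I hI (Away.mk _ hℓ n a ha) = Ideal.Quotient.mk I a := by
  have h1 : Ideal.Quotient.mk I ℓ = 1 := by rw [Ideal.Quotient.eq.mpr hI, map_one]
  rw [dehom, RingHom.comp_apply, HomogeneousLocalization.algebraMap_apply, Away.val_mk,
    Localization.mk_eq_mk',
    IsLocalization.Away.lift, IsLocalization.lift_mk'_spec]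
  simp [h1]

lemma dehom_fromZeroRingHom (c : k) :
    dehom I hI (fromZeroRingHom _ _ (algebraMap k (homogeneousSubmodule σ k 0) c)) =
      algebraMap k _ c := by
  rw [dehom, RingHom.comp_apply, HomogeneousLocalization.algebraMap_apply]
  exact IsLocalization.Away.lift_eq _ _ (C c)

include hℓ in
-- The homogeneous component `a_n` of a polynomial is the image of the fraction `a_n / ℓ ^ n`.
lemma dehom_surjective : Function.Surjective (dehom I hI) := by
  intro b
  obtain ⟨a, rfl⟩ := Ideal.Quotient.mk_surjective b
  rw [← RingHom.mem_range, ← sum_homogeneousComponent a, map_sum]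
  refine sum_mem fun n _ ↦ ⟨Away.mk _ hℓ n (homogeneousComponent n a) ?_, dehom_mk hℓ I hI _ _ _⟩
  rw [smul_eq_mul, mul_one]
  exact homogeneousComponent_mem _ _

lemma X_mem_one_smul (i : σ) : (X i : MvPolynomial σ k) ∈ homogeneousSubmodule σ k (1 • 1) :=
  isHomogeneous_X k i

/-- The substitution of `x / ℓ` for the variables `x`. -/
def divHom : MvPolynomial σ k →+* Away (homogeneousSubmodule σ k) ℓ :=
  eval₂Hom ((fromZeroRingHom _ _).comp (algebraMap k (homogeneousSubmodule σ k 0)))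
    fun i ↦ Away.mk _ hℓ 1 (X i) (X_mem_one_smul i)

/-- In the full localization each `x / ℓ` is `c * x` with `c = 1 / ℓ`, and homogeneity pulls out the
factor `c ^ n`. -/
lemma divHom_apply (n : ℕ) (a : MvPolynomial σ k)
    (ha : a ∈ homogeneousSubmodule σ k (n • 1)) :
    divHom hℓ a = Away.mk _ hℓ n a ha := by
  apply val_injective
  have ha' : a.IsHomogeneous n := by simpa using ha
  let c : Localization.Away ℓ := Localization.mk 1 ⟨ℓ, 1, pow_one ℓ⟩
  change algebraMap (Away (homogeneousSubmodule σ k) ℓ) (Localization.Away ℓ) _ = _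
  rw [divHom, coe_eval₂Hom, hom_eval₂]
  have h1 : (fun i ↦ algebraMap (Away (homogeneousSubmodule σ k) ℓ) (Localization.Away ℓ)
      (Away.mk _ hℓ 1 (X i) (X_mem_one_smul i))) =
      fun i ↦ c * algebraMap (MvPolynomial σ k) (Localization.Away ℓ) (X i) := by
    funext i
    rw [HomogeneousLocalization.algebraMap_apply, Away.val_mk, ← Localization.mk_one_eq_algebraMap,
      Localization.mk_mul]
    simp
  have h2 : eval₂ ((algebraMap (MvPolynomial σ k) (Localization.Away ℓ)).comp C)
      (fun i ↦ algebraMap (MvPolynomial σ k) (Localization.Away ℓ) (X i)) a = algebraMap _ _ a := by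
    rw [← hom_eval₂, eval₂_eta]
  have h3 : (algebraMap (Away (homogeneousSubmodule σ k) ℓ) (Localization.Away ℓ)).comp
      ((fromZeroRingHom _ _).comp (algebraMap k (homogeneousSubmodule σ k 0))) =
      (algebraMap (MvPolynomial σ k) (Localization.Away ℓ)).comp C := by
    ext x
    rfl
  change eval₂ _ (fun i ↦ algebraMap (Away (homogeneousSubmodule σ k) ℓ) (Localization.Away ℓ)
      (Away.mk _ hℓ 1 (X i) (X_mem_one_smul i))) a = _
  rw [h1, h3, eval₂_mul_of_isHomogeneous _ _ _ ha', h2, Away.val_mk, Localization.mk_pow,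
    ← Localization.mk_one_eq_algebraMap, Localization.mk_mul, one_pow, mul_one, one_mul]
  exact congrArg _ (Subtype.ext rfl)

lemma divHom_self : divHom hℓ ℓ = 1 := by
  rw [divHom_apply hℓ 1 ℓ (by simpa using hℓ)]
  apply val_injective
  rw [Away.val_mk, val_one]
  simp only [pow_one]
  exact Localization.mk_self (⟨ℓ, _⟩ : Submonoid.powers ℓ)

/-- A prime of the coordinate ring of the complement of a hyperplane contains the kernel of the
dehomogenization map if it contains the dehomogenizations of the equations. -/
lemma ker_dehom_le_of_forall_mem (S : Set (MvPolynomial σ k))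
    (hI : ℓ - 1 ∈ Ideal.span (insert (ℓ - 1) S))
    (p : Ideal (Away (homogeneousSubmodule σ k) ℓ)) (hp : ∀ s ∈ S, divHom hℓ s ∈ p) :
    RingHom.ker (dehom _ hI) ≤ p := by
  intro x hx
  obtain ⟨n, a, ha, rfl⟩ := Away.mk_surjective _ hℓ x
  rw [RingHom.mem_ker, dehom_mk, Ideal.Quotient.eq_zero_iff_mem] at hx
  -- Here `a / ℓ ^ n` is the value of `divHom` at `a`, so it suffices to check the generators of the
  -- ideal; `ℓ - 1` goes to `0`.
  rw [← divHom_apply]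
  change a ∈ p.comap (divHom hℓ)
  refine Ideal.span_le.mpr ?_ hx
  rintro s (rfl | hs)
  · simp [divHom_self]
  · exact hp s hs

end Dehomogenize

/-! ### Cutting projective varieties into affine strata -/

section Stratification

open MvPolynomial HomogeneousLocalization

attribute [local instance] MvPolynomial.gradedAlgebra

variable {k : Type u} [Field k] {σ : Type}

/-- The projective variety cut out by a set of homogeneous polynomials. -/
abbrev projVar [Finite σ] (S : Set (MvPolynomial σ k)) : Var k :=
  Var.mk' (redSubι ⟨ProjectiveSpectrum.zeroLocus (homogeneousSubmodule σ k) S,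
    ProjectiveSpectrum.isClosed_zeroLocus _ _⟩ ≫ ProjSp.str k σ)

lemma range_redSubι {X : Scheme.{u}} (Z : TopologicalSpace.Closeds X) :
    Set.range (redSubι Z) = Z := by
  rw [Scheme.IdealSheafData.range_subschemeι,
    Scheme.IdealSheafData.coe_support_vanishingIdeal]

variable {ℓ : MvPolynomial σ k} (hℓ : ℓ ∈ homogeneousSubmodule σ k 1)

/-- The inclusion of the complement of a hyperplane. -/
abbrev hyperplaneCompl :
    Spec (.of (Away (homogeneousSubmodule σ k) ℓ)) ⟶ ProjSp k σ :=
  Proj.awayι (homogeneousSubmodule σ k) ℓ hℓ one_pos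

lemma hyperplaneCompl_str : hyperplaneCompl hℓ ≫ ProjSp.str k σ =
    Spec.map (CommRingCat.ofHom ((fromZeroRingHom _ _).comp
      (algebraMap k (homogeneousSubmodule σ k 0)))) := by
  rw [ProjSp.str, Proj.awayι_toSpecZero_assoc, ← Spec.map_comp]
  rfl

lemma mem_hyperplaneCompl_iff {s : MvPolynomial σ k} {m : ℕ} (hs : s.IsHomogeneous m)
    (hm : 0 < m) (p : Spec (.of (Away (homogeneousSubmodule σ k) ℓ))) :
    s ∈ (hyperplaneCompl hℓ p).asHomogeneousIdeal ↔ divHom hℓ s ∈ p.asIdeal := by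
  have h := congr(p ∈ $(Proj.awayι_preimage_basicOpen (homogeneousSubmodule σ k) hℓ one_pos
    (g := s) hs hm))
  have h' : (s ∉ (hyperplaneCompl hℓ p).asHomogeneousIdeal) =
    (Away.isLocalizationElem hℓ (g := s) hs ∉ p.asIdeal) := h
  have hs' : s ∈ homogeneousSubmodule σ k (m • 1) := by simpa using hs
  -- The localization element is `s ^ deg ℓ / ℓ ^ m`, and `deg ℓ = 1`.
  have e : Away.isLocalizationElem hℓ (g := s) hs = divHom hℓ s := by
    rw [divHom_apply hℓ m s hs']
    apply val_injective
    rw [Away.val_mk, Away.val_mk, pow_one]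
  rw [e] at h'
  exact not_iff_not.mp (iff_of_eq h')

include hℓ in
/-- Cutting a projective variety by a hyperplane and its complement. -/
lemma cls_projVar_eq_add [Finite σ] (S : Set (MvPolynomial σ k))
    (hS : ∀ s ∈ S, ∃ m, 0 < m ∧ s.IsHomogeneous m) :
    cls (projVar S) = affCls k (MvPolynomial σ k ⧸ Ideal.span (insert (ℓ - 1) S)) +
      cls (projVar (insert ℓ S)) := by
  let I := Ideal.span (insert (ℓ - 1) S)
  have hI : ℓ - 1 ∈ I := Ideal.subset_span (Set.mem_insert _ _)
  let B := MvPolynomial σ k ⧸ I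
  let φ : Away (homogeneousSubmodule σ k) ℓ →+* B ⧸ nilradical B :=
    (Ideal.Quotient.mk _).comp (dehom I hI)
  have hφ : Function.Surjective φ :=
    Ideal.Quotient.mk_surjective.comp (dehom_surjective hℓ I hI)
  have := isClosedImmersion_specMap (R := Away (homogeneousSubmodule σ k) ℓ)
    (S := B ⧸ nilradical B) φ hφ
  refine cls_eq_add (X := projVar S) (T := redSpec k B) (Y := projVar (insert ℓ S))
    (ProjSp.str k σ) (hyperplaneCompl hℓ) (redSubι _) (redSubι _) (Spec.map (CommRingCat.ofHom φ))
    rfl rfl ?_ ?_ ?_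
  · rw [hyperplaneCompl_str, ← Spec.map_comp, ← CommRingCat.ofHom_comp]
    congr 2
    ext c
    exact congrArg (Ideal.Quotient.mk _) (dehom_fromZeroRingHom I hI c)
  · have h : Set.range (hyperplaneCompl hℓ) =
        (Proj.basicOpen (homogeneousSubmodule σ k) ℓ : Set (ProjSp k σ)) :=
      congrArg (fun U : (ProjSp k σ).Opens ↦ (U : Set (ProjSp k σ)))
        (Proj.opensRange_awayι (homogeneousSubmodule σ k) ℓ hℓ one_pos)
    rw [range_redSubι, range_redSubι, h]
    ext p
    change insert ℓ S ⊆ _ ↔ S ⊆ _ ∧ ¬ ¬ ℓ ∈ _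
    rw [not_not, Set.insert_subset_iff, and_comm]
    rfl
  · rw [range_redSubι, range_specMap_of_surjective _ hφ]
    ext p
    have h1 : p ∈ PrimeSpectrum.zeroLocus (RingHom.ker φ : Set (Away _ ℓ)) ↔
      RingHom.ker φ ≤ p.asIdeal := Iff.rfl
    have h2 : p ∈ hyperplaneCompl hℓ ⁻¹'
        (ProjectiveSpectrum.zeroLocus (homogeneousSubmodule σ k) S) ↔
        ∀ s ∈ S, s ∈ (hyperplaneCompl hℓ p).asHomogeneousIdeal := Iff.rfl
    refine h1.trans (Iff.trans ⟨fun h s hs ↦ ?_, fun h ↦ ?_⟩ h2.symm)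
    · obtain ⟨m, hm, hsm⟩ := hS s hs
      refine (mem_hyperplaneCompl_iff hℓ hsm hm p).mpr (h ?_)
      rw [RingHom.mem_ker, RingHom.comp_apply,
        divHom_apply hℓ m s (by simpa using hsm), dehom_mk,
        Ideal.Quotient.eq_zero_iff_mem.mpr (Ideal.subset_span (Set.mem_insert_of_mem _ hs)),
        map_zero]
    · intro x hx
      rw [RingHom.mem_ker, RingHom.comp_apply, Ideal.Quotient.eq_zero_iff_mem,
        mem_nilradical] at hx
      obtain ⟨N, hN⟩ := hx
      rw [← map_pow, ← RingHom.mem_ker] at hN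
      -- Only a power of `x` lies in the kernel of `dehom`, because `φ` also kills nilpotents;
      -- primality of `p` removes the exponent.
      refine p.isPrime.mem_of_pow_mem N (ker_dehom_le_of_forall_mem hℓ S hI _ (fun s hs ↦ ?_) hN)
      obtain ⟨m, hm, hsm⟩ := hS s hs
      exact (mem_hyperplaneCompl_iff hℓ hsm hm p).mp (h s hs)

include hℓ in
/-- A common zero of the equations at which some linear form does not vanish gives a rational
point. -/
lemma nonempty_point_of_algHom [Finite σ] (S : Set (MvPolynomial σ k))
    (hS : ∀ s ∈ S, ∃ m, 0 < m ∧ s.IsHomogeneous m) (φ : MvPolynomial σ k →ₐ[k] k)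
    (hφ : φ ℓ = 1) (hφS : ∀ s ∈ S, φ s = 0) : Nonempty (pt k ⟶ projVar S) := by
  -- With this choice of ideal, dehomogenization followed by `φ` evaluates `a / ℓ ^ n` as `φ a`.
  let I := RingHom.ker φ.toRingHom
  have hI : ℓ - 1 ∈ I := by
    change φ (ℓ - 1) = 0
    rw [map_sub, hφ, map_one, sub_self]
  let ψ : Away (homogeneousSubmodule σ k) ℓ →+* k :=
    (Ideal.Quotient.lift I φ.toRingHom fun _ ↦ id).comp (dehom I hI)
  let f : Spec (.of k) ⟶ ProjSp k σ := Spec.map (CommRingCat.ofHom ψ) ≫ hyperplaneCompl hℓ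
  have hf : f ≫ ProjSp.str k σ = 𝟙 _ := by
    rw [Category.assoc, hyperplaneCompl_str, ← Spec.map_comp, ← CommRingCat.ofHom_comp,
      ← Spec.map_id]
    congr 1
    ext c
    exact (congrArg (Ideal.Quotient.lift I φ.toRingHom fun _ ↦ id)
      (dehom_fromZeroRingHom I hI c)).trans (φ.commutes c)
  obtain ⟨l, hl⟩ := exists_lift_of_range_subset (redSubι ⟨ProjectiveSpectrum.zeroLocus
    (homogeneousSubmodule σ k) S, ProjectiveSpectrum.isClosed_zeroLocus _ _⟩) f (by
      rw [range_redSubι]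
      rintro _ ⟨p, rfl⟩ s hs
      obtain ⟨m, hm, hsm⟩ := hS s hs
      refine (mem_hyperplaneCompl_iff hℓ hsm hm _).mpr ?_
      change ψ (divHom hℓ s) ∈ p.asIdeal
      have : ψ (divHom hℓ s) = φ s := by
        rw [divHom_apply hℓ m s (by simpa using hsm), RingHom.comp_apply, dehom_mk]
        rfl
      rw [this, hφS s hs]
      exact zero_mem _)
  exact ⟨Var.homMk' l (((reassoc_of% hl) (ProjSp.str k σ)).trans hf)⟩

/-- The ideal of the stratum of `V(S)` where `Y j = 1` and the later forms of the family `Y`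
vanish. -/
abbrev stratumIdeal {N : ℕ} (S : Set (MvPolynomial σ k)) (Y : Fin N → MvPolynomial σ k)
    (j : Fin N) : Ideal (MvPolynomial σ k) :=
  Ideal.span (insert (Y j - 1) (S ∪ Y '' Set.Ioi j))

lemma affCls_quotient_congr {A : Type u} [CommRing A] [Algebra k A] [Algebra.FiniteType k A]
    {I J : Ideal A} (h : I = J) : affCls k (A ⧸ I) = affCls k (A ⧸ J) := by
  subst h
  rfl

/-- The forms are split off from the last one down: the part where it is nonzero is the last
stratum, and on the rest it joins the equations `S`, which is why the induction generalizes over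
`S`. -/
lemma cls_projVar_eq_sum_add [Finite σ] {N : ℕ} (Y : Fin N → MvPolynomial σ k)
    (hY : ∀ j, (Y j).IsHomogeneous 1) (S : Set (MvPolynomial σ k))
    (hS : ∀ s ∈ S, ∃ m, 0 < m ∧ s.IsHomogeneous m) :
    cls (projVar S) = ∑ j, affCls k (MvPolynomial σ k ⧸ stratumIdeal S Y j) +
      cls (projVar (S ∪ Set.range Y)) := by
  induction N generalizing S with
  | zero => simp
  | succ N ih =>
    have hS' : ∀ s ∈ insert (Y (Fin.last N)) S, ∃ m, 0 < m ∧ s.IsHomogeneous m := by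
      rintro s (rfl | hs)
      exacts [⟨1, one_pos, hY _⟩, hS s hs]
    rw [cls_projVar_eq_add (hY (Fin.last N)) S hS, Fin.sum_univ_castSucc,
      ih (fun j ↦ Y j.castSucc) (fun j ↦ hY _) _ hS']
    have h1 : stratumIdeal S Y (Fin.last N) = Ideal.span (insert (Y (Fin.last N) - 1) S) := by
      rw [stratumIdeal, show Set.Ioi (Fin.last N) = ∅ by ext; simp [Fin.le_last],
        Set.image_empty, Set.union_empty]
    have h2 (j : Fin N) : stratumIdeal (insert (Y (Fin.last N)) S) (fun j ↦ Y j.castSucc) j =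
        stratumIdeal S Y j.castSucc := by
      have : Set.Ioi j.castSucc = insert (Fin.last N) (Fin.castSucc '' Set.Ioi j) := by
        ext i
        refine Fin.lastCases (by simp [Fin.castSucc_lt_last]) (fun i ↦ ?_) i
        simp [Fin.le_last]
      rw [stratumIdeal, stratumIdeal, this, Set.image_insert_eq, Set.image_image,
        Set.union_insert, Set.insert_union]
    have h3 : insert (Y (Fin.last N)) S ∪ Set.range (fun j ↦ Y (Fin.castSucc j)) =
        S ∪ Set.range Y := by
      ext p
      simp [Fin.exists_fin_succ', or_assoc, or_left_comm, or_comm, eq_comm]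
    rw [h1, h3, Finset.sum_congr rfl fun j _ ↦ affCls_quotient_congr (h2 j)]
    ring

/-- A polynomial in the irrelevant ideal has no constant term, so it lies in the ideal of the
variables; no point of `Proj` contains the irrelevant ideal. -/
lemma zeroLocus_eq_empty {S : Set (MvPolynomial σ k)}
    (hspan : ∀ s, X s ∈ Ideal.span S) :
    ProjectiveSpectrum.zeroLocus (homogeneousSubmodule σ k) S = ∅ := by
  rw [Set.eq_empty_iff_forall_notMem]
  intro p hp
  have hp' : S ⊆ p.asHomogeneousIdeal := hp
  refine p.not_irrelevant_le fun a ha ↦ ?_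
  have h1 : Ideal.span S ≤ p.asHomogeneousIdeal.toIdeal := Ideal.span_le.mpr hp'
  have h2 : a ∈ Ideal.span (Set.range (X : σ → MvPolynomial σ k)) := by
    rw [← Set.image_univ, mem_ideal_span_X_image]
    intro m hm
    by_contra! h
    have hm0 : m = 0 := Finsupp.ext fun i ↦ h i (Set.mem_univ i)
    rw [mem_support_iff, hm0] at hm
    have : homogeneousComponent 0 a = 0 :=
      (decomposition.decompose'_apply a 0).symm.trans
        ((HomogeneousIdeal.mem_irrelevant_iff _ _).mp ha)
    rw [homogeneousComponent_zero] at this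
    exact hm (C_injective _ _ (this.trans (map_zero C).symm))
  exact h1 (Ideal.span_le.mpr (Set.range_subset_iff.mpr hspan) h2)

/-- The class of a projective variety is the sum of the classes of its strata with respect to a
system of linear coordinates. -/
lemma cls_projVar_eq_sum [Finite σ] {N : ℕ} (Y : Fin N → MvPolynomial σ k)
    (hY : ∀ j, (Y j).IsHomogeneous 1) (hspan : ∀ s, X s ∈ Ideal.span (Set.range Y))
    (S : Set (MvPolynomial σ k)) (hS : ∀ s ∈ S, ∃ m, 0 < m ∧ s.IsHomogeneous m) :
    cls (projVar S) = ∑ j, affCls k (MvPolynomial σ k ⧸ stratumIdeal S Y j) := by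
  rw [cls_projVar_eq_sum_add Y hY S hS]
  have : IsEmpty (projVar (S ∪ Set.range Y)).sch :=
    ⟨fun x ↦ Set.eq_empty_iff_forall_notMem.mp ((range_redSubι _).trans (zeroLocus_eq_empty fun s ↦
      Ideal.span_mono Set.subset_union_right (hspan s))) _ (Set.mem_range_self x)⟩
  rw [cls_eq_zero_of_isEmpty, add_zero]

end Stratification

/-! ### Linear forms, codimension and changes of coordinates -/

section LinearForms

open MvPolynomial

variable {k : Type u} [Field k] {σ : Type}

/-- The coefficients of a linear form, as a linear functional. -/
def linearPart [Fintype σ] : MvPolynomial σ k →ₗ[k] Module.Dual k (σ → k) :=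
  ∑ s, (lcoeff k (Finsupp.single s 1)).smulRight (LinearMap.proj s : (σ → k) →ₗ[k] k)

lemma linearPart_apply [Fintype σ] (f : MvPolynomial σ k) (v : σ → k) :
    linearPart f v = ∑ s, coeff (Finsupp.single s 1) f * v s := by
  simp [linearPart]

lemma eq_sum_X_of_isHomogeneous [Fintype σ] {f : MvPolynomial σ k} (hf : f.IsHomogeneous 1) :
    f = ∑ s, C (coeff (Finsupp.single s 1) f) * X s := by
  classical
  have hf' : f ∈ Submodule.span k (Set.range X) := by
    rwa [← homogeneousSubmodule_one_eq_span_X]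
  induction hf' using Submodule.span_induction with
  | mem x hx =>
    obtain ⟨i, rfl⟩ := hx
    simp [coeff_X, Finsupp.single_left_inj]
  | zero => simp
  | add x y hx hy hx' hy' =>
    rw [← homogeneousSubmodule_one_eq_span_X] at hx hy
    nth_rw 1 [hx' hx, hy' hy, ← Finset.sum_add_distrib]
    simp [add_mul]
  | smul a x hx hx' =>
    rw [← homogeneousSubmodule_one_eq_span_X] at hx
    nth_rw 1 [hx' hx]
    simp [Finset.smul_sum, smul_eq_C_mul, mul_assoc]

lemma eval_eq_linearPart [Fintype σ] {f : MvPolynomial σ k} (hf : f.IsHomogeneous 1) (v : σ → k) :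
    eval v f = linearPart f v := by
  rw [linearPart_apply]
  nth_rw 1 [eq_sum_X_of_isHomogeneous hf]
  simp

lemma linearPart_injOn [Fintype σ] :
    Set.InjOn (linearPart (k := k) (σ := σ)) (homogeneousSubmodule σ k 1) := by
  classical
  intro f hf g hg h
  rw [eq_sum_X_of_isHomogeneous hf, eq_sum_X_of_isHomogeneous hg]
  refine Finset.sum_congr rfl fun s _ ↦ ?_
  have := congr($h (Pi.single s 1))
  simp only [linearPart_apply, Pi.single_apply, mul_ite, mul_one, mul_zero, Finset.sum_ite_eq',
    Finset.mem_univ, if_true] at this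
  rw [this]

/-- The codimension of a linear subspace is the rank of the equations. -/
lemma linearCodim_eq_finrank_span [Finite σ] {ι : Type} (h : ι → MvPolynomial σ k)
    (hlin : ∀ i, (h i).IsHomogeneous 1) :
    linearCodim h = Module.finrank k (Submodule.span k (Set.range h)) := by
  have := Fintype.ofFinite σ
  let Φ : Subspace k (Module.Dual k (σ → k)) := (Submodule.span k (Set.range h)).map linearPart
  -- The common zeros are the vectors killed by the span of the forms, viewed in the dual space;
  -- duality then turns codimension into rank.
  have h1 : Submodule.span k {v : σ → k | ∀ i, eval v (h i) = 0} = Φ.dualCoannihilator := by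
    apply le_antisymm
    · rw [Submodule.span_le]
      intro v hv
      rw [SetLike.mem_coe, Submodule.mem_dualCoannihilator]
      rintro _ ⟨f, hf, rfl⟩
      induction hf using Submodule.span_induction with
      | mem x hx =>
        obtain ⟨i, rfl⟩ := hx
        rw [← eval_eq_linearPart (hlin i), hv i]
      | zero => simp
      | add x y _ _ hx hy => rw [map_add, LinearMap.add_apply, hx, hy, add_zero]
      | smul a x _ hx => rw [map_smul, LinearMap.smul_apply, hx, smul_zero]
    · intro v hv
      refine Submodule.subset_span fun i ↦ ?_
      rw [eval_eq_linearPart (hlin i)]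
      exact (Submodule.mem_dualCoannihilator v).mp hv _
        ⟨h i, Submodule.subset_span ⟨i, rfl⟩, rfl⟩
  have h2 : Submodule.span k (Set.range h) ≤ homogeneousSubmodule σ k 1 :=
    Submodule.span_le.mpr (Set.range_subset_iff.mpr hlin)
  have h3 : Module.finrank k Φ = Module.finrank k (Submodule.span k (Set.range h)) := by
    have h4 : Function.Injective (linearPart.domRestrict (Submodule.span k (Set.range h))) :=
      fun x y hxy ↦ Subtype.ext (linearPart_injOn (h2 x.2) (h2 y.2) hxy)
    rw [← LinearMap.finrank_range_of_inj h4, LinearMap.range_domRestrict]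
  rw [linearCodim, h1, ← h3]
  have h4 := Subspace.finrank_add_finrank_dualCoannihilator_eq Φ
  have h5 := Submodule.finrank_quotient_add_finrank Φ.dualCoannihilator
  omega

lemma finrank_homogeneousSubmodule_one [Fintype σ] :
    Module.finrank k (homogeneousSubmodule σ k 1) = Fintype.card σ := by
  rw [homogeneousSubmodule_one_eq_span_X]
  exact finrank_span_eq_card (linearIndependent_X σ k)

/-- A basis of the span of the `h i` serves as `y`, and the coordinates of `h i` in this basis are
the coefficients of `g i`. -/
lemma exists_isCoordinateForm [Finite σ] {ι : Type} (h : ι → MvPolynomial σ k) [Finite ι]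
    (hlin : ∀ i, (h i).IsHomogeneous 1) :
    ∃ (y : Fin (linearCodim h) → MvPolynomial σ k)
      (g : ι → MvPolynomial (Fin (linearCodim h)) k), IsCoordinateForm y g h := by
  have : FiniteDimensional k (Submodule.span k (Set.range h)) :=
    FiniteDimensional.span_of_finite k (Set.finite_range h)
  let b := Module.finBasisOfFinrankEq k _ (linearCodim_eq_finrank_span h hlin).symm
  have h2 : Submodule.span k (Set.range h) ≤ homogeneousSubmodule σ k 1 :=
    Submodule.span_le.mpr (Set.range_subset_iff.mpr hlin)
  let c (i : ι) : Submodule.span k (Set.range h) := ⟨h i, Submodule.subset_span ⟨i, rfl⟩⟩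
  refine ⟨fun j ↦ b j, fun i ↦ ∑ j, C (b.repr (c i) j) * X j, fun j ↦ h2 (b j).2,
    b.linearIndependent.map' (Submodule.subtype _) (Submodule.ker_subtype _),
    fun i ↦ IsHomogeneous.sum _ _ _ fun j _ ↦ isHomogeneous_C_mul_X _ _, fun i ↦ ?_⟩
  have := congrArg Subtype.val (b.sum_repr (c i))
  rw [map_sum, ← show _ = h i from this, AddSubmonoidClass.coe_finsetSum]
  refine Finset.sum_congr rfl fun j _ ↦ ?_
  rw [map_mul, algHom_C, aeval_X, Submodule.coe_smul, algebraMap_eq, smul_eq_C_mul]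

/-- A basis of the space of linear forms gives linear coordinates. -/
def coordEquiv [Fintype σ] {τ : Type} (b : Module.Basis τ k (homogeneousSubmodule σ k 1)) :
    MvPolynomial τ k ≃ₐ[k] MvPolynomial σ k :=
  let L : homogeneousSubmodule σ k 1 →ₗ[k] MvPolynomial τ k := b.constr k X
  let x (s : σ) : homogeneousSubmodule σ k 1 := ⟨X s, isHomogeneous_X k s⟩
  let inv : MvPolynomial σ k →ₐ[k] MvPolynomial τ k := aeval fun s ↦ L (x s)
  have hx (v : homogeneousSubmodule σ k 1) :
      v = ∑ s, coeff (Finsupp.single s 1) (v : MvPolynomial σ k) • x s := by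
    apply Subtype.ext
    rw [AddSubmonoidClass.coe_finsetSum]
    simp only [Submodule.coe_smul, smul_eq_C_mul, x]
    exact eq_sum_X_of_isHomogeneous v.2
  have hinv (v : homogeneousSubmodule σ k 1) : inv v = L v := by
    rw [hx v, AddSubmonoidClass.coe_finsetSum, map_sum, map_sum]
    refine Finset.sum_congr rfl fun s _ ↦ ?_
    rw [Submodule.coe_smul, map_smul, map_smul]
    exact congrArg _ (aeval_X _ _)
  have hL (v : homogeneousSubmodule σ k 1) :
      aeval (fun j ↦ (b j : MvPolynomial σ k)) (L v) = v := by
    have : (aeval (fun j ↦ (b j : MvPolynomial σ k))).toLinearMap ∘ₗ L = Submodule.subtype _ :=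
      b.ext fun j ↦ by
        rw [LinearMap.comp_apply, Module.Basis.constr_basis]
        exact aeval_X _ _
    exact congr($this v)
  AlgEquiv.ofAlgHom (aeval fun j ↦ (b j : MvPolynomial σ k)) inv
    (algHom_ext fun s ↦ by
      rw [AlgHom.comp_apply, aeval_X, hL, AlgHom.id_apply])
    (algHom_ext fun j ↦ by
      rw [AlgHom.comp_apply, aeval_X, hinv, Module.Basis.constr_basis, AlgHom.id_apply])

lemma coordEquiv_apply [Fintype σ] {τ : Type} (b : Module.Basis τ k (homogeneousSubmodule σ k 1))
    (f : MvPolynomial τ k) : coordEquiv b f = aeval (fun j ↦ (b j : MvPolynomial σ k)) f := rfl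

/-- Linearly independent linear forms are the last members of a system of coordinates. -/
lemma exists_coordinates [Fintype σ] {r m : ℕ} (hrm : r + m = Fintype.card σ)
    (y : Fin r → MvPolynomial σ k) (hy : ∀ j, (y j).IsHomogeneous 1)
    (hli : LinearIndependent k y) :
    ∃ e : MvPolynomial (Fin (r + m)) k ≃ₐ[k] MvPolynomial σ k,
      (∀ j, (e (X j)).IsHomogeneous 1) ∧ (∀ s, X s ∈ Ideal.span (Set.range fun j ↦ e (X j))) ∧
      ∀ j, e (X (Fin.addNat j m)) = y j := by
  let v (j : Fin r) : homogeneousSubmodule σ k 1 := ⟨y j, hy j⟩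
  have hv : LinearIndependent k v := .of_comp (Submodule.subtype _) hli
  have hfr := finrank_homogeneousSubmodule_one (k := k) (σ := σ)
  have hfin : Module.Finite k (homogeneousSubmodule σ k 1) := by
    rw [homogeneousSubmodule_one_eq_span_X]
    exact FiniteDimensional.span_of_finite k (Set.finite_range _)
  have hb₀ (j) : Module.Basis.sumExtend hv (Sum.inl j) = v j := by
    rw [Module.Basis.sumExtend, Module.Basis.reindex_apply, Module.Basis.extend_apply_self]
    rfl
  let b₀ := Module.Basis.sumExtend hv
  have : Finite (Module.Basis.sumExtendIndex hv) :=
    have := Module.Finite.finite_basis b₀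
    Finite.of_injective _ (Sum.inr_injective (α := Fin r))
  have := Fintype.ofFinite (Module.Basis.sumExtendIndex hv)
  have hcard : Fintype.card (Module.Basis.sumExtendIndex hv) = m := by
    have := Module.finrank_eq_card_basis b₀
    rw [hfr, Fintype.card_sum, Fintype.card_fin] at this
    omega
  -- The summands are swapped so that the given forms come last: the cone construction adds its free
  -- variables in front, by `Fin.succ`.
  let ε : Fin r ⊕ Module.Basis.sumExtendIndex hv ≃ Fin (r + m) :=
    (Equiv.sumCongr (Equiv.refl _) (Fintype.equivFinOfCardEq hcard)).trans
      ((Equiv.sumComm _ _).trans (finSumFinEquiv.trans (finCongr (Nat.add_comm m r))))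
  have hε (j) : ε (Sum.inl j) = Fin.addNat j m := by
    ext
    simp [ε, Nat.add_comm]
  let b := b₀.reindex ε
  refine ⟨coordEquiv b, fun j ↦ ?_, fun s ↦ ?_, fun j ↦ ?_⟩
  · rw [coordEquiv_apply, aeval_X]
    exact (b j).2
  · have h1 := congrArg Subtype.val (b.sum_repr ⟨X s, isHomogeneous_X k s⟩)
    rw [← show _ = X s from h1, AddSubmonoidClass.coe_finsetSum]
    refine sum_mem fun j _ ↦ ?_
    rw [Submodule.coe_smul, smul_eq_C_mul]
    refine Ideal.mul_mem_left _ _ (Ideal.subset_span ⟨j, ?_⟩)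
    simp only [coordEquiv_apply, aeval_X]
  · rw [coordEquiv_apply, aeval_X, ← hε, Module.Basis.reindex_apply, Equiv.symm_apply_apply]
    exact congrArg Subtype.val (hb₀ j)

end LinearForms

/-! ### The class of a cone -/

section Cone

open MvPolynomial

variable {k : Type u} [Field k]

/-- The sum of the classes of the strata of `V(f)` in standard coordinates. -/
def strataSum {N : ℕ} (f : MvPolynomial (Fin N) k) : K0 k :=
  ∑ j, affCls k (MvPolynomial (Fin N) k ⧸ stratumIdeal {f} X j)

lemma map_stratumIdeal {σ τ : Type} {N : ℕ} (e : MvPolynomial σ k ≃ₐ[k] MvPolynomial τ k)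
    (f : MvPolynomial σ k) (Y : Fin N → MvPolynomial σ k) (j : Fin N) :
    stratumIdeal {e f} (fun i ↦ e (Y i)) j =
      (stratumIdeal {f} Y j).map (e : MvPolynomial σ k →+* MvPolynomial τ k) := by
  rw [stratumIdeal, stratumIdeal, Ideal.map_span, Set.image_insert_eq, Set.image_union,
    Set.image_image, Set.image_singleton, map_sub, map_one]
  rfl

/-- `e` carries the standard strata of `f` to the strata of `e f` in the coordinates `e (X j)`. -/
lemma cls_projVar_eq_strataSum {σ : Type} [Finite σ] {N : ℕ}
    (e : MvPolynomial (Fin N) k ≃ₐ[k] MvPolynomial σ k) (he : ∀ j, (e (X j)).IsHomogeneous 1)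
    (hspan : ∀ s, X s ∈ Ideal.span (Set.range fun j ↦ e (X j)))
    (f : MvPolynomial (Fin N) k) (hf : ∃ m, 0 < m ∧ (e f).IsHomogeneous m) :
    cls (projVar {e f}) = strataSum f := by
  rw [cls_projVar_eq_sum _ he hspan _ (by rintro _ rfl; exact hf), strataSum]
  refine Finset.sum_congr rfl fun j _ ↦ ?_
  exact (affCls_eq_of_algEquiv (Ideal.quotientEquivAlg _ _ e (map_stratumIdeal e f X j))).symm

/-- Evaluation at the point `(1, 0, …, 0)`. -/
abbrev vertexHom (N : ℕ) : MvPolynomial (Fin (N + 1)) k →ₐ[k] k :=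
  aeval (Fin.cons 1 fun _ ↦ 0)

lemma vertexHom_rename_succ {N : ℕ} (f : MvPolynomial (Fin N) k) :
    vertexHom N (rename Fin.succ f) = constantCoeff f := by
  rw [aeval_rename]
  have : (Fin.cons 1 (fun _ ↦ 0) : Fin (N + 1) → k) ∘ Fin.succ = 0 := by ext; simp
  rw [this, aeval_zero]
  simp

lemma ker_vertexHom {N : ℕ} (f : MvPolynomial (Fin N) k) (hf : constantCoeff f = 0) :
    RingHom.ker (vertexHom (k := k) N) = stratumIdeal {rename Fin.succ f} X 0 := by
  apply le_antisymm
  · intro p hp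
    -- Modulo the ideal each variable equals its value at the vertex, so the quotient map factors
    -- through evaluation there.
    have h : Ideal.Quotient.mkₐ k (stratumIdeal {rename Fin.succ f} X (0 : Fin (N + 1))) =
        (Algebra.ofId k _).comp (vertexHom N) := by
      refine algHom_ext fun i ↦ ?_
      rw [AlgHom.comp_apply, aeval_X]
      refine Fin.cases ?_ (fun i ↦ ?_) i
      · rw [Fin.cons_zero, map_one, ← map_one (Ideal.Quotient.mkₐ k _)]
        exact Ideal.Quotient.eq.mpr (Ideal.subset_span (Set.mem_insert _ _))
      · rw [Fin.cons_succ, map_zero]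
        exact Ideal.Quotient.eq_zero_iff_mem.mpr (Ideal.subset_span (Set.mem_insert_of_mem _
          (Or.inr ⟨_, Fin.succ_pos i, rfl⟩)))
    have h2 := congr($h p)
    rw [AlgHom.comp_apply, RingHom.mem_ker.mp hp, map_zero] at h2
    exact Ideal.Quotient.eq_zero_iff_mem.mp h2
  · refine Ideal.span_le.mpr ?_
    rintro _ (rfl | rfl | ⟨i, hi, rfl⟩)
    · simp [RingHom.mem_ker]
    · exact (vertexHom_rename_succ f).trans hf
    · obtain ⟨i, rfl⟩ := Fin.exists_succ_eq.mpr (ne_of_gt hi)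
      simp [RingHom.mem_ker]

lemma affCls_stratum_zero {N : ℕ} (f : MvPolynomial (Fin N) k) (hf : constantCoeff f = 0) :
    affCls k (MvPolynomial (Fin (N + 1)) k ⧸ stratumIdeal {rename Fin.succ f} X 0) = 1 := by
  have hsurj : Function.Surjective (vertexHom (k := k) N) := fun c ↦ ⟨C c, algHom_C _ _⟩
  rw [← affCls_quotient_congr (ker_vertexHom f hf), ← affCls_self k]
  exact affCls_eq_of_algEquiv (Ideal.quotientKerAlgEquivOfSurjective hsurj)

lemma finSuccEquiv_rename_succ {N : ℕ} (f : MvPolynomial (Fin N) k) :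
    finSuccEquiv k N (rename Fin.succ f) = Polynomial.C f := by
  have : ((finSuccEquiv k N : _ →ₐ[k] _).comp (rename Fin.succ)) =
      (Polynomial.CAlgHom : MvPolynomial (Fin N) k →ₐ[MvPolynomial (Fin N) k] _).restrictScalars k :=
    algHom_ext fun i ↦ by simp [finSuccEquiv_X_succ]
  exact congr($this f)

lemma map_finSuccEquiv_stratumIdeal {N : ℕ} (f : MvPolynomial (Fin N) k) (j : Fin N) :
    (stratumIdeal {f} X j).map Polynomial.C =
      (stratumIdeal {rename Fin.succ f} X j.succ).map
        (finSuccEquiv k N : _ →+* Polynomial (MvPolynomial (Fin N) k)) := by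
  have h : Set.Ioi j.succ = Fin.succ '' Set.Ioi j := by
    ext i
    refine Fin.cases (by simp) (fun i ↦ by simp) i
  rw [stratumIdeal, stratumIdeal, Ideal.map_span, Ideal.map_span, Set.image_insert_eq,
    Set.image_insert_eq, Set.image_union, Set.image_union, h, Set.image_image, Set.image_image,
    Set.image_image, Set.image_singleton, Set.image_singleton]
  simp [finSuccEquiv_X_succ, finSuccEquiv_rename_succ]

/-- None of the equations of this stratum involves the variable with index `0`, so its coordinate
ring is a polynomial ring over that of the old stratum. -/
lemma affCls_stratum_succ {N : ℕ} (f : MvPolynomial (Fin N) k) (j : Fin N) :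
    affCls k (MvPolynomial (Fin (N + 1)) k ⧸ stratumIdeal {rename Fin.succ f} X j.succ) =
      𝕃 k * affCls k (MvPolynomial (Fin N) k ⧸ stratumIdeal {f} X j) := by
  rw [← affCls_polynomial]
  let I := stratumIdeal {f} X j
  let ψ : Polynomial (MvPolynomial (Fin N) k) →ₐ[k] Polynomial (MvPolynomial (Fin N) k ⧸ I) :=
    Polynomial.mapAlgHom (Ideal.Quotient.mkₐ k I)
  have hψ : Function.Surjective ψ := Polynomial.map_surjective _ Ideal.Quotient.mk_surjective
  have hker : RingHom.ker ψ = I.map Polynomial.C :=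
    (Polynomial.ker_mapRingHom (Ideal.Quotient.mk I)).trans (by rw [Ideal.mk_ker])
  exact affCls_eq_of_algEquiv ((Ideal.quotientEquivAlg _ _ (finSuccEquiv k N)
    (hker.trans (map_finSuccEquiv_stratumIdeal f j))).trans
      (Ideal.quotientKerAlgEquivOfSurjective hψ))

/-- The class of a cone over a projective variety. -/
lemma strataSum_rename_succ {N : ℕ} (f : MvPolynomial (Fin N) k) (hf : constantCoeff f = 0) :
    strataSum (rename Fin.succ f) = 1 + 𝕃 k * strataSum f := by
  rw [strataSum, strataSum, Fin.sum_univ_succ, affCls_stratum_zero f hf, Finset.mul_sum]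
  simp_rw [affCls_stratum_succ]

/-- The class of an iterated cone over a projective variety. -/
lemma strataSum_rename_addNat {r : ℕ} (m : ℕ) (f : MvPolynomial (Fin r) k)
    (hf : constantCoeff f = 0) :
    strataSum (rename (Fin.addNat · m) f) =
      (∑ j ∈ Finset.range m, 𝕃 k ^ j) + 𝕃 k ^ m * strataSum f := by
  induction m with
  | zero =>
    have : rename (Fin.addNat · 0) f = f := rename_id_apply f
    rw [this, Finset.range_zero, Finset.sum_empty, pow_zero, zero_add, one_mul]
  | succ m ih =>
    have h : rename (Fin.addNat · (m + 1)) f = rename Fin.succ (rename (Fin.addNat · m) f) := by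
      rw [rename_rename]
      rfl
    rw [h, strataSum_rename_succ _ (by simpa using hf), ih, Finset.sum_range_succ', mul_add,
      Finset.mul_sum]
    simp_rw [pow_succ']
    ring

end Cone

/-! ### Unions of hyperplanes as iterated cones -/

section Arrangements

open MvPolynomial

variable {k : Type u} [Field k] {ι : Type} [Fintype ι]

lemma isHomogeneous_prod_linear {σ : Type} (h : ι → MvPolynomial σ k)
    (hlin : ∀ i, (h i).IsHomogeneous 1) : (∏ i, h i).IsHomogeneous (Fintype.card ι) := by
  simpa using IsHomogeneous.prod Finset.univ h (fun _ ↦ 1) fun i _ ↦ hlin i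

/-- The number of hyperplanes bounds the codimension of their intersection. -/
lemma linearCodim_le_card {σ : Type} [Finite σ] (h : ι → MvPolynomial σ k)
    (hlin : ∀ i, (h i).IsHomogeneous 1) : linearCodim h ≤ Fintype.card ι := by
  rw [linearCodim_eq_finrank_span h hlin]
  exact finrank_range_le_card h

lemma linearCodim_pos {σ : Type} [Finite σ] (h : ι → MvPolynomial σ k)
    (hlin : ∀ i, (h i).IsHomogeneous 1) {i : ι} (hi : h i ≠ 0) : 1 ≤ linearCodim h := by
  have : FiniteDimensional k (Submodule.span k (Set.range h)) :=
    FiniteDimensional.span_of_finite k (Set.finite_range h)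
  rw [linearCodim_eq_finrank_span h hlin, Submodule.one_le_finrank_iff]
  exact fun h0 ↦ hi ((Submodule.mem_bot k).mp (h0 ▸ Submodule.subset_span ⟨i, rfl⟩))

variable {n r m : ℕ} (hrm : r + m = n + 1)
  {h : ι → MvPolynomial (Fin (n + 1)) k} (hlin : ∀ i, (h i).IsHomogeneous 1)
  {y : Fin r → MvPolynomial (Fin (n + 1)) k} {g : ι → MvPolynomial (Fin r) k}
  (H : IsCoordinateForm y g h)

include H hrm

lemma IsCoordinateForm.exists_equiv :
    ∃ e : MvPolynomial (Fin (r + m)) k ≃ₐ[k] MvPolynomial (Fin (n + 1)) k,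
      (∀ j, (e (X j)).IsHomogeneous 1) ∧ (∀ s, X s ∈ Ideal.span (Set.range fun j ↦ e (X j))) ∧
      e (rename (Fin.addNat · m) (∏ i, g i)) = ∏ i, h i := by
  obtain ⟨e, he, hspan, hey⟩ := exists_coordinates (by simpa using hrm) y
    H.isHomogeneous_coord H.linearIndependent
  refine ⟨e, he, hspan, ?_⟩
  have : (e : _ →ₐ[k] _).comp (rename (Fin.addNat · m)) = aeval y :=
    algHom_ext fun j ↦ by simp [hey]
  rw [map_prod, map_prod]
  refine Finset.prod_congr rfl fun i _ ↦ ?_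
  rw [← H.aeval_eq i, ← this]
  rfl

include hlin

variable [Nonempty ι]

/-- A union of hyperplanes with a common zero is an iterated cone. -/
lemma IsCoordinateForm.cls_hypersurface : cls (hypersurface (∏ i, h i)) =
    (∑ j ∈ Finset.range m, 𝕃 k ^ j) + 𝕃 k ^ m * cls (hypersurface (∏ i, g i)) := by
  obtain ⟨e, he, hspan, heg⟩ := H.exists_equiv hrm
  have hg := isHomogeneous_prod_linear g H.isHomogeneous
  -- The product has positive degree because there is at least one hyperplane; hence the vertex lies
  -- on the cone.
  have hg0 : constantCoeff (∏ i, g i) = 0 :=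
    hg.coeff_eq_zero (by simpa using Fintype.card_ne_zero.symm)
  have h1 : cls (projVar {∏ i, h i}) = strataSum (rename (Fin.addNat · m) (∏ i, g i)) := by
    rw [← heg]
    exact cls_projVar_eq_strataSum e he hspan _
      ⟨_, Fintype.card_pos, heg ▸ isHomogeneous_prod_linear h hlin⟩
  have h2 : cls (projVar {∏ i, g i}) = strataSum (∏ i, g i) :=
    cls_projVar_eq_strataSum AlgEquiv.refl (isHomogeneous_X k)
      (fun s ↦ Ideal.subset_span ⟨s, rfl⟩) _ ⟨_, Fintype.card_pos, hg⟩
  -- `hypersurface f` is `projVar {f}` by definition.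
  exact h1.trans ((strataSum_rename_addNat m _ hg0).trans (by rw [← h2]; rfl))

/-- With at least one free variable, the vertex `(1, 0, …, 0)` in the new coordinates is a rational
point. -/
lemma IsCoordinateForm.nonempty_point (hm : 1 ≤ m) :
    Nonempty (pt k ⟶ hypersurface (∏ i, h i)) := by
  obtain ⟨m, rfl⟩ := Nat.exists_eq_add_of_le' hm
  obtain ⟨e, he, hspan, heg⟩ := H.exists_equiv hrm
  have hg0 : constantCoeff (rename (Fin.addNat · m) (∏ i, g i)) = 0 := by
    rw [constantCoeff_rename]
    exact (isHomogeneous_prod_linear g H.isHomogeneous).coeff_eq_zero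
      (by simpa using Fintype.card_ne_zero.symm)
  refine nonempty_point_of_algHom (he 0) {∏ i, h i}
    (by rintro _ rfl; exact ⟨_, Fintype.card_pos, isHomogeneous_prod_linear h hlin⟩)
    ((vertexHom (r + m)).comp (e.symm : _ →ₐ[k] _)) ?_ ?_
  · simp
  · rintro _ rfl
    have h1 : rename (Fin.addNat · (m + 1)) (∏ i, g i) =
        rename Fin.succ (rename (Fin.addNat · m) (∏ i, g i)) := by
      rw [rename_rename]
      rfl
    rw [← heg, h1, AlgHom.comp_apply]
    refine (congrArg _ (e.symm_apply_apply _)).trans ?_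
    rw [vertexHom_rename_succ, hg0]

end Arrangements

end MotivicClass

end

/-! ### The main theorem -/

open MotivicClass
theorem theorem5p1 {k : Type u} [Field k] (n d : ℕ) (hd : 1 ≤ d) (hdn : d ≤ n)
    (h : Fin d → MvPolynomial (Fin (n + 1)) k)
    (hlin : ∀ i, (h i).IsHomogeneous 1) (hne : ∀ i, h i ≠ 0) :
    -- `X = V(h_1 ⋯ h_d)` has a `k`-rational point
    Nonempty (pt k ⟶ hypersurface (∏ i, h i)) ∧
    -- `[X] ≡ 1 mod 𝕃`
    cls (hypersurface (∏ i, h i)) ≡ 1 [SMOD Ideal.span {𝕃 k}] ∧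
    -- the codimension `r` of the common intersection satisfies `1 ≤ r ≤ n`
    1 ≤ linearCodim h ∧ linearCodim h ≤ n ∧
    -- there are coordinates in which all `h_i` involve only the first `r` variables
    (∃ (y : Fin (linearCodim h) → MvPolynomial (Fin (n + 1)) k)
      (g : Fin d → MvPolynomial (Fin (linearCodim h)) k), IsCoordinateForm y g h) ∧
    -- for all such coordinates, `[X] = 1 + 𝕃 + ⋯ + 𝕃^(n-r) + 𝕃^(n-r+1) [Z]`,
    -- where `Z = V(g_1 ⋯ g_d)` in the projective space of dimension `r - 1`
    ∀ (y : Fin (linearCodim h) → MvPolynomial (Fin (n + 1)) k)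
      (g : Fin d → MvPolynomial (Fin (linearCodim h)) k), IsCoordinateForm y g h →
      cls (hypersurface (∏ i, h i)) =
        (∑ j ∈ Finset.range (n - linearCodim h + 1), 𝕃 k ^ j) +
          𝕃 k ^ (n - linearCodim h + 1) * cls (hypersurface (∏ i, g i)) := by
  have : Nonempty (Fin d) := ⟨⟨0, hd⟩⟩
  have hr1 : 1 ≤ linearCodim h := linearCodim_pos h hlin (hne ⟨0, hd⟩)
  have hrn : linearCodim h ≤ n :=
    (linearCodim_le_card h hlin).trans ((Fintype.card_fin d).trans_le hdn)
  -- The number of free variables is `m = n - r + 1`, which is at least `1`.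
  have hrm : linearCodim h + (n - linearCodim h + 1) = n + 1 := by omega
  obtain ⟨y, g, H⟩ := exists_isCoordinateForm h hlin
  refine ⟨H.nonempty_point hrm hlin (Nat.le_add_left _ _), ?_, hr1, hrn, ⟨y, g, H⟩,
    fun y g H ↦ H.cls_hypersurface hrm hlin⟩
  -- Removing the term `𝕃 ^ 0 = 1` leaves only multiples of `𝕃`.
  rw [SModEq.sub_mem, H.cls_hypersurface hrm hlin, Finset.sum_range_succ', pow_zero,
    add_right_comm, add_sub_cancel_right, Ideal.mem_span_singleton]
  exact dvd_add (Finset.dvd_sum fun j _ ↦ dvd_pow_self _ j.succ_ne_zero)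
    ((dvd_pow_self _ (Nat.succ_ne_zero _)).mul_right _)
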